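/- **Setting.** Let $f:\mathbb R^n\to\mathbb R$ be convex and bounded below, let $\lambda>0$, and let $\phi:\mathbb R^n\times\mathbb R^n\to\mathbb R$ be a $\phi$-regular function: $\phi$ is $C^1$; $\phi\ge 0$, with $\phi(z,x)=0$ iff $z=x$; there are $\beta,L>0$ such that for all $z,z',x,x'$ $$\phi(z',x')-\phi(z,x)\ge\nabla_z\phi(z,x)^T(z'-z)+\nabla_x\phi(z,x)^T(x'-x)+\beta\|(z'-z)-(x'-x)\|^2,$$ $$\|\nabla\phi(z',x')-\nabla\phi(z,x)\|\le L\|(z'-z)-(x'-x)\|;$$ and $\nabla_z\phi=-\nabla_x\phi$. Put $f_\phi(x)=\min_z\{f(z)+\frac1\lambda\phi(z,x)\}$ and $g=\nabla f_\phi$. For all $x$ and $\varepsilon>0$ let $p^a(x,\varepsilon)$ satisfy $f(p^a(x,\varepsilon))+\frac1\lambda\phi(p^a(x,\varepsilon),x)\le f_\phi(x)+\varepsilon$, and put $f^a_\phi(x,\varepsilon)=f(p^a(x,\varepsilon))+\frac1\lambda\phi(p^a(x,\varepsilon),x)$ and $g^a(x,\varepsilon)=\frac1\lambda\nabla_x\phi(p^a(x,\varepsilon),x)$.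 **Algorithm.** Fix $a>0$, $\delta>0$, $\rho\in(0,1)$, $c_1>0$, an integer $M\ge1$, a forcing function $\varphi:[0,\infty)\to[0,\infty)$ (for nonnegative $t_i$, $\varphi(t_i)\to0$ implies $t_i\to0$) and a nonincreasing $\psi:[0,\infty)\to[0,1)$ with $\psi(t)>0$ for $t>0$. Start from $x^0\in\mathbb R^n$ and $\varepsilon_0>0$. At step $k$, stop if $g^a(x^k,\varepsilon_k)=0$. Otherwise choose a symmetric positive semidefinite matrix $V_k$ and $\alpha_k>0$; put $d^k=-(V_k+\alpha_kI)^{-1}g^a(x^k,\varepsilon_k)$, $\gamma^k=-g^a(x^k,\varepsilon_k)^Td^k/\|d^k\|$ and $\gamma_k=\min\{\delta,\ c_1\varphi(\gamma^k)+\psi(\|g^a(x^k,\varepsilon_k)\|)\}$; choose $0<\varepsilon_{k+1}\le\frac12\varepsilon_k$ and an integer $m(k)\ge 0$ with $m(0)=0$ and $m(k)\le\min\{m(k-1)+1,M\}$ for $k\ge1$; let $\tau_k=\rho^{h_k}a$, where $h_k$ is the least integer $h\ge0$ with $$f^a_\phi(x^k+\rho^had^k,\varepsilon_{k+1})\le\max_{0\le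 j\le m(k)}f^a_\phi(x^{k-j},\varepsilon_{k-j})+\gamma_k\rho^ha\,g^a(x^k,\varepsilon_k)^Td^k+\varepsilon_k;$$ and put $x^{k+1}=x^k+\tau_kd^k$. **B-subdifferential.** $\partial_Bg(x)$ is the set of all limits of $\nabla g(u^i)$ with $u^i\to x$ and $g$ differentiable at $u^i$. The map $g$ is BD-regular at $x$ if it is Lipschitz continuous and every element of $\partial_Bg(x)$ is nonsingular. **Theorem.** Suppose that the algorithm does not stop and generates $\{x^k\}$, that the eigenvalues of the matrices $V_k+\alpha_kI$ are uniformly bounded, that $\bar x$ minimizes $f$, and that $g$ is BD-regular at $\bar x$. Suppose furthermore that 1. $\varepsilon_k=o(\|g(x^k)\|^2)$; 2. $\operatorname{dist}(V_k,\partial_Bg(x^k))\to0$ and $\alpha_k\to0$, and there is a constant $l$ such that for all large $k$, all $y=x^k+\theta(\bar x-x^k)$ with $0\le\theta<1$, all $A\in\partial_Bg(x^k)$ and all $B\in\partial_Bg(y)$, $\|A-B\|\le l\,\|x^k-y\|$; 3. $a=1$, and $\tau_k=1$ for all large $k$. Then $x^k\to\bar x$, $x^k\ne\bar x$ for all large $k$,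 and the convergence is Q-superlinear and two-step Q-superlinear: $$\lim_{k\to\infty}\frac{\|x^{k+1}-\bar x\|}{\|x^k-\bar x\|}=0,\qquad\lim_{k\to\infty}\frac{\|x^{k+2}-\bar x\|}{\|x^k-\bar x\|}=0.$$ Moreover there is a constant $C$ such that for all large $k$ $$\|x^{k+1}-\bar x\|\le C\Big(\|x^k-\bar x\|^2+\big(\alpha_k+\operatorname{dist}(V_k,\partial_Bg(x^k))\big)\|x^k-\bar x\|+\sqrt{\varepsilon_k}\Big).$$ -/

import Mathlib

open Filter Topology Asymptotics

noncomputable section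

/-- Euclidean space of dimension `n`. -/
abbrev Rn (n : ℕ) : Type := EuclideanSpace ℝ (Fin n)

/-- Partial gradient of `φ (z, x)` with respect to `z`. -/
def gradZ {n : ℕ} (φ : Rn n → Rn n → ℝ) (z x : Rn n) : Rn n :=
  gradient (fun z' => φ z' x) z

/-- Partial gradient of `φ (z, x)` with respect to `x`. -/
def gradX {n : ℕ} (φ : Rn n → Rn n → ℝ) (z x : Rn n) : Rn n :=
  gradient (fun x' => φ z x') x

/-- `φ`-regular functions. -/
structure IsPhiRegular {n : ℕ} (φ : Rn n → Rn n → ℝ) : Prop where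
  contDiff : ContDiff ℝ 1 (fun q : Rn n × Rn n => φ q.1 q.2)
  nonneg : ∀ z x, 0 ≤ φ z x
  eq_zero_iff : ∀ z x, φ z x = 0 ↔ z = x
  strong_convex : ∃ β : ℝ, 0 < β ∧ ∀ z' z x' x : Rn n,
    φ z' x' - φ z x ≥ inner ℝ (gradZ φ z x) (z' - z) + inner ℝ (gradX φ z x) (x' - x)
      + β * ‖(z' - z) - (x' - x)‖ ^ 2
  lipschitz : ∃ L : ℝ, 0 < L ∧ ∀ z' z x' x : Rn n,
    Real.sqrt (‖gradZ φ z' x' - gradZ φ z x‖ ^ 2 + ‖gradX φ z' x' - gradX φ z x‖ ^ 2)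
      ≤ L * ‖(z' - z) - (x' - x)‖
  gradZ_eq_neg : ∀ z x, gradZ φ z x = - gradX φ z x

/-- The objective `f z + φ (z, x) / lam` of the regularizing subproblem at `x`. -/
def subObj {n : ℕ} (f : Rn n → ℝ) (φ : Rn n → Rn n → ℝ) (lam : ℝ) (z x : Rn n) : ℝ :=
  f z + (1 / lam) * φ z x

/-- The `φ`-regularization `x ↦ min over z of f z + φ (z, x) / lam`. -/
def phiReg {n : ℕ} (f : Rn n → ℝ) (φ : Rn n → Rn n → ℝ) (lam : ℝ) (x : Rn n) : ℝ :=
  ⨅ z : Rn n, subObj f φ lam z x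

/-- The gradient `g` of the `φ`-regularization. -/
def phiGrad {n : ℕ} (f : Rn n → ℝ) (φ : Rn n → Rn n → ℝ) (lam : ℝ) (x : Rn n) : Rn n :=
  gradient (phiReg f φ lam) x

/-- `pa x e` solves the subproblem at `x` up to the error `e`, for all `x` and all `e > 0`. -/
def IsApproxProx {n : ℕ} (f : Rn n → ℝ) (φ : Rn n → Rn n → ℝ) (lam : ℝ)
    (pa : Rn n → ℝ → Rn n) : Prop :=
  ∀ (x : Rn n) (e : ℝ), 0 < e → subObj f φ lam (pa x e) x ≤ phiReg f φ lam x + e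

/-- Approximate value of the `φ`-regularization. -/
def approxVal {n : ℕ} (f : Rn n → ℝ) (φ : Rn n → Rn n → ℝ) (lam : ℝ)
    (pa : Rn n → ℝ → Rn n) (x : Rn n) (e : ℝ) : ℝ :=
  subObj f φ lam (pa x e) x

/-- Approximate gradient of the `φ`-regularization. -/
def approxGrad {n : ℕ} (φ : Rn n → Rn n → ℝ) (lam : ℝ)
    (pa : Rn n → ℝ → Rn n) (x : Rn n) (e : ℝ) : Rn n :=
  (1 / lam) • gradX φ (pa x e) x

/-- Forcing functions on `[0, ∞)`; values at negative arguments are irrelevant. -/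
structure IsForcing (ϕ : ℝ → ℝ) : Prop where
  nonneg : ∀ t, 0 ≤ t → 0 ≤ ϕ t
  forcing : ∀ t : ℕ → ℝ, (∀ i, 0 ≤ t i) →
    Tendsto (fun i => ϕ (t i)) atTop (𝓝 0) → Tendsto t atTop (𝓝 0)

/-- The constants and functions fixed before the first iteration. -/
structure GAParams where
  a : ℝ
  δ : ℝ
  ρ : ℝ
  c₁ : ℝ
  M : ℕ
  forc : ℝ → ℝ
  ψ : ℝ → ℝ
  a_pos : 0 < a
  δ_pos : 0 < δ
  ρ_pos : 0 < ρ
  ρ_lt_one : ρ < 1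
  c₁_pos : 0 < c₁
  M_pos : 0 < M
  isForcing : IsForcing forc
  ψ_nonneg : ∀ t, 0 ≤ t → 0 ≤ ψ t
  ψ_lt_one : ∀ t, 0 ≤ t → ψ t < 1
  ψ_anti : AntitoneOn ψ (Set.Ici 0)
  ψ_pos : ∀ t, 0 < t → 0 < ψ t

/-- The line-search coefficient for an approximate gradient `G` and a direction `d`. -/
def GAParams.coeff {n : ℕ} (P : GAParams) (G d : Rn n) : ℝ :=
  min P.δ (P.c₁ * P.forc (-(inner ℝ G d) / ‖d‖) + P.ψ ‖G‖)

/-- The sequences of an infinite run of the algorithm: iterates, directions, matrices (as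
linear operators), shifts, accuracies, step lengths, line-search exponents, memory lengths. -/
structure GARun (n : ℕ) where
  x : ℕ → Rn n
  d : ℕ → Rn n
  V : ℕ → (Rn n →L[ℝ] Rn n)
  α : ℕ → ℝ
  ε : ℕ → ℝ
  τ : ℕ → ℝ
  h : ℕ → ℕ
  m : ℕ → ℕ

/-- The nonmonotone acceptance test for the exponent `i` at iteration `k`. -/
def GARun.Accepts {n : ℕ} (R : GARun n) (P : GAParams) (f : Rn n → ℝ) (φ : Rn n → Rn n → ℝ)
    (lam : ℝ) (pa : Rn n → ℝ → Rn n) (k i : ℕ) : Prop :=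
  approxVal f φ lam pa (R.x k + (P.ρ ^ i * P.a) • R.d k) (R.ε (k + 1)) ≤
    (Finset.range (R.m k + 1)).sup' Finset.nonempty_range_add_one
        (fun j => approxVal f φ lam pa (R.x (k - j)) (R.ε (k - j)))
      + P.coeff (approxGrad φ lam pa (R.x k) (R.ε k)) (R.d k) * (P.ρ ^ i * P.a)
          * inner ℝ (approxGrad φ lam pa (R.x k) (R.ε k)) (R.d k)
      + R.ε k

/-- `R` is generated by the algorithm, and the algorithm never stops. -/
structure GARun.IsGenerated {n : ℕ} (R : GARun n) (P : GAParams) (f : Rn n → ℝ)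
    (φ : Rn n → Rn n → ℝ) (lam : ℝ) (pa : Rn n → ℝ → Rn n) : Prop where
  ε_pos : ∀ k, 0 < R.ε k
  ε_succ : ∀ k, R.ε (k + 1) ≤ (1 / 2) * R.ε k
  not_stop : ∀ k, approxGrad φ lam pa (R.x k) (R.ε k) ≠ 0
  V_pos : ∀ k, (R.V k).IsPositive
  α_pos : ∀ k, 0 < R.α k
  direction : ∀ k, (R.V k + R.α k • ContinuousLinearMap.id ℝ (Rn n)) (R.d k)
    = - approxGrad φ lam pa (R.x k) (R.ε k)
  m_zero : R.m 0 = 0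
  m_succ : ∀ k, R.m (k + 1) ≤ min (R.m k + 1) P.M
  exponent : ∀ k, IsLeast {i : ℕ | R.Accepts P f φ lam pa k i} (R.h k)
  step : ∀ k, R.τ k = P.ρ ^ R.h k * P.a
  next : ∀ k, R.x (k + 1) = R.x k + R.τ k • R.d k

/-- The B-subdifferential of `g` at `x`: all limits of Jacobians of `g` at points of
differentiability tending to `x`. -/
def bSubdiff {n : ℕ} (g : Rn n → Rn n) (x : Rn n) : Set (Rn n →L[ℝ] Rn n) :=
  {A | ∃ u : ℕ → Rn n, (∀ i, DifferentiableAt ℝ g (u i)) ∧ Tendsto u atTop (𝓝 x) ∧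
    Tendsto (fun i => fderiv ℝ g (u i)) atTop (𝓝 A)}

/-- BD-regularity of `g` at `x`. -/
def IsBDRegular {n : ℕ} (g : Rn n → Rn n) (x : Rn n) : Prop :=
  (∃ K : NNReal, LipschitzWith K g) ∧ ∀ A ∈ bSubdiff g x, IsUnit A

end

/-! Write `F` for the regularization and `g` for its gradient. `F` is convex, minimal at `xbar`, and
replacing `g` by the approximate gradient costs only `O(√ε)` (`phiReg_gradient`). Jacobians of `g`
are therefore symmetric positive semidefinite; BD-regularity makes their limits at `xbar`
nonsingular, and compactness then gives a uniform bound `κ > 0` from below on a whole ball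
(`exists_uniform_pos_of_isBDRegular`).

Inside that ball a unit step is a perturbed Newton step. Its error consists of the Newton remainder,
quadratic by `norm_newton_le`, the errors of `V` and `α`, and the gradient error
(`norm_newton_step_sub_le`). Since `√ε = o(‖g‖)` and `g` is Lipschitz with `g xbar = 0`, the step
contracts by any prescribed factor close enough to `xbar`.

It remains to enter the ball. The line search keeps the values bounded, and `growth_of_uniform_pos`
then bounds the iterates. Gradients bounded away from zero would force a fixed decrease forever
(`frequently_lt_of_nonmonotone`), so small gradients recur, and by the same growth lemma they occur
only near `xbar`. A single late visit suffices, because the contraction traps the sequence. -/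

/-! ### Mean value inequalities for Lipschitz maps. -/

open MeasureTheory in
/-- Mean value inequality for a Lipschitz map whose Jacobians, wherever they exist in an open
convex set, satisfy a lower bound in a fixed direction. -/
theorem le_inner_sub_of_forall_fderiv {n : ℕ} {g : Rn n → Rn n} {K : NNReal}
    (hg : LipschitzWith K g) {U : Set (Rn n)} (hU : IsOpen U) (hUc : Convex ℝ U)
    {v w : Rn n} {c : ℝ}
    (hc : ∀ u ∈ U, DifferentiableAt ℝ g u → c ≤ inner ℝ w (fderiv ℝ g u v))
    {x : Rn n} (hx : x ∈ U) (hxv : x + v ∈ U) : c ≤ inner ℝ w (g (x + v) - g x) := by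
  let T : ℝ →ₗ[ℝ] Rn n := LinearMap.toSpanSingleton ℝ (Rn n) v
  -- The given segment may miss the points of differentiability altogether. By Rademacher and
  -- Fubini, almost every parallel line meets them almost everywhere.
  have hae : ∀ᵐ p : Rn n, ∀ᵐ t : ℝ, p + T t ∈ {u | DifferentiableAt ℝ g u} :=
    (ae_ae_add_linearMap_mem_iff T volume volume (measurableSet_of_differentiableAt ℝ g)).2
      hg.ae_differentiableAt
  have hgood : ∀ p ∈ U, p + v ∈ U → (∀ᵐ t : ℝ, p + T t ∈ {u | DifferentiableAt ℝ g u}) →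
      c ≤ inner ℝ w (g (p + v) - g p) := by
    intro p hp hpv hae
    let q : ℝ → ℝ := fun t => inner ℝ w (g (p + t • v))
    have hlip : LipschitzWith (‖w‖₊ * (K * ‖v‖₊)) q := by
      refine LipschitzWith.of_dist_le_mul fun s t => ?_
      simp only [q, Real.dist_eq, ← inner_sub_right]
      refine (abs_real_inner_le_norm _ _).trans ?_
      have h1 : ‖g (p + s • v) - g (p + t • v)‖ ≤ K * (‖v‖ * |s - t|) := by
        refine (hg.norm_sub_le _ _).trans (le_of_eq ?_)
        rw [add_sub_add_left_eq_sub, ← sub_smul, norm_smul, Real.norm_eq_abs]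
        ring
      calc ‖w‖ * ‖g (p + s • v) - g (p + t • v)‖ ≤ ‖w‖ * (K * (‖v‖ * |s - t|)) := by gcongr
        _ = _ := by push_cast; ring
    have hac : AbsolutelyContinuousOnInterval q 0 1 :=
      (hlip.lipschitzOnWith (s := Set.uIcc 0 1)).absolutelyContinuousOnInterval
    have hint := hac.integral_deriv_eq_sub
    have hle : ∫ _ in (0 : ℝ)..1, c ≤ ∫ t in (0 : ℝ)..1, deriv q t := by
      refine intervalIntegral.integral_mono_ae_restrict zero_le_one (by simp)
        hac.intervalIntegrable_deriv ?_
      rw [EventuallyLE, ae_restrict_iff' measurableSet_Icc]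
      filter_upwards [hae] with t ht ht01
      have hd : HasDerivAt (fun s : ℝ => p + s • v) v t := by
        simpa using ((hasDerivAt_id t).smul_const v).const_add p
      have hd2 : HasDerivAt (fun s : ℝ => g (p + s • v)) (fderiv ℝ g (p + t • v) v) t :=
        (show DifferentiableAt ℝ g (p + t • v) from ht).hasFDerivAt.comp_hasDerivAt t hd
      have hd3 : HasDerivAt q (inner ℝ w (fderiv ℝ g (p + t • v) v)) t := by
        simpa [q] using (hasDerivAt_const t w).inner ℝ hd2
      rw [hd3.deriv]
      refine hc _ ?_ ht
      have := hUc.add_smul_sub_mem hp hpv ht01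
      simpa using this
    rw [hint] at hle
    simpa [q, inner_sub_right] using hle
  -- The inequality is a closed condition on the base point, so its validity on a dense set of base
  -- points suffices.
  by_contra hlt
  push Not at hlt
  have hcont : Continuous fun p => inner ℝ w (g (p + v) - g p) := by
    have := hg.continuous
    fun_prop
  have hev : ∀ᶠ p in 𝓝 x, p ∈ U ∧ p + v ∈ U ∧ inner ℝ w (g (p + v) - g p) < c := by
    refine Filter.Eventually.and (hU.mem_nhds hx) (Filter.Eventually.and ?_ ?_)
    · exact (continuous_id.add continuous_const).continuousAt.eventually (hU.mem_nhds hxv)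
    · exact hcont.continuousAt.eventually (gt_mem_nhds hlt)
  obtain ⟨p, ⟨h1, h2, h3⟩, h4⟩ := mem_closure_iff_nhds.1 (Measure.dense_of_ae hae x) _ hev
  exact absurd (hgood p h1 h2 h4) (not_le.2 h3)

/-- A Lipschitz map on an open convex set is Lipschitz around an affine map when its Jacobians are
close to the linear part. -/
theorem norm_sub_sub_le_of_forall_fderiv {n : ℕ} {g : Rn n → Rn n} {K : NNReal}
    (hg : LipschitzWith K g) {U : Set (Rn n)} (hU : IsOpen U) (hUc : Convex ℝ U)
    {A : Rn n →L[ℝ] Rn n} {c : ℝ}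
    (hc : ∀ u ∈ U, DifferentiableAt ℝ g u → ‖fderiv ℝ g u - A‖ ≤ c)
    {x y : Rn n} (hx : x ∈ U) (hy : y ∈ U) : ‖g y - g x - A (y - x)‖ ≤ c * ‖y - x‖ := by
  set r := g y - g x - A (y - x) with hr
  -- Testing against the residual itself bounds `‖r‖ ^ 2`; the sign turns the lower mean value bound
  -- into an upper one.
  have h := le_inner_sub_of_forall_fderiv hg hU hUc (v := y - x) (w := -r)
    (c := inner ℝ (-r) (A (y - x)) - ‖r‖ * (c * ‖y - x‖)) (fun u hu hd => by
      have h1 : inner ℝ r (fderiv ℝ g u (y - x) - A (y - x)) ≤ ‖r‖ * (c * ‖y - x‖) := by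
        refine (real_inner_le_norm _ _).trans ?_
        gcongr
        exact ((fderiv ℝ g u - A).le_opNorm (y - x)).trans
          (mul_le_mul_of_nonneg_right (hc u hu hd) (norm_nonneg _))
      rw [inner_sub_right] at h1
      rw [inner_neg_left, inner_neg_left]
      linarith) hx (by simpa using hy)
  rw [add_sub_cancel] at h
  have h2 : inner ℝ r r ≤ ‖r‖ * (c * ‖y - x‖) := by
    conv_lhs => rw [hr, inner_sub_right, ← hr]
    rw [inner_neg_left, inner_neg_left] at h
    linarith
  rw [real_inner_self_eq_norm_mul_norm] at h2
  rcases (norm_nonneg r).eq_or_lt with h0 | h0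
  · rw [← h0]
    rcases (norm_nonneg (y - x)).eq_or_lt with h3 | h3
    · simp [← h3]
    -- A zero residual still requires `0 ≤ c`, which any point of differentiability in `U` provides.
    · obtain ⟨u, hu⟩ := mem_closure_iff_nhds.1
        (MeasureTheory.Measure.dense_of_ae
          (hg.ae_differentiableAt (μ := MeasureTheory.volume)) x) _ (hU.mem_nhds hx)
      exact mul_nonneg ((norm_nonneg _).trans (hc u hu.1 hu.2)) (norm_nonneg _)
  · exact le_of_mul_le_mul_left h2 h0

/-! ### The regularized function and its gradient. -/

/-- As the partial gradients are opposite, only the relative displacement `(z' - z) - (x' - x)`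
matters. The upper bound is the lower one with the two points exchanged, the gradient being moved
back by its Lipschitz estimate. -/
theorem IsPhiRegular.exists_bounds {n : ℕ} {φ : Rn n → Rn n → ℝ} (hφ : IsPhiRegular φ) :
    ∃ β L : ℝ, 0 < β ∧ 0 < L ∧
      (∀ z' z x' x, φ z x - inner ℝ (gradX φ z x) ((z' - z) - (x' - x))
        + β * ‖(z' - z) - (x' - x)‖ ^ 2 ≤ φ z' x') ∧
      (∀ z' z x' x, φ z' x' ≤ φ z x - inner ℝ (gradX φ z x) ((z' - z) - (x' - x))
        + L * ‖(z' - z) - (x' - x)‖ ^ 2) ∧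
      ∀ z' z x' x, ‖gradX φ z' x' - gradX φ z x‖ ≤ L * ‖(z' - z) - (x' - x)‖ := by
  obtain ⟨β, hβ, hsc⟩ := hφ.strong_convex
  obtain ⟨L, hL, hlip⟩ := hφ.lipschitz
  have h1 : ∀ z' z x' x, φ z x - inner ℝ (gradX φ z x) ((z' - z) - (x' - x))
        + β * ‖(z' - z) - (x' - x)‖ ^ 2 ≤ φ z' x' := by
    intro z' z x' x
    have h := hsc z' z x' x
    rw [hφ.gradZ_eq_neg, inner_neg_left] at h
    rw [inner_sub_right]
    linarith
  have h2 : ∀ z' z x' x, ‖gradX φ z' x' - gradX φ z x‖ ≤ L * ‖(z' - z) - (x' - x)‖ := by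
    intro z' z x' x
    refine le_trans (Real.le_sqrt_of_sq_le ?_) (hlip z' z x' x)
    linarith [sq_nonneg ‖gradZ φ z' x' - gradZ φ z x‖]
  refine ⟨β, L, hβ, hL, h1, ?_, h2⟩
  intro z' z x' x
  have h := h1 z z' x x'
  have hneg : (z - z') - (x - x') = -((z' - z) - (x' - x)) := by abel
  rw [hneg, norm_neg, inner_neg_right] at h
  have h3 := h2 z' z x' x
  set w := (z' - z) - (x' - x)
  have h4 : -(inner ℝ (gradX φ z' x' - gradX φ z x) w) ≤ L * ‖w‖ * ‖w‖ := by
    refine (neg_le_abs _).trans ((abs_real_inner_le_norm _ _).trans ?_)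
    gcongr
  rw [inner_sub_left] at h4
  nlinarith [mul_nonneg hβ.le (sq_nonneg ‖w‖)]

theorem bddBelow_subObj {n : ℕ} {f : Rn n → ℝ} {φ : Rn n → Rn n → ℝ} {lam : ℝ}
    (hφ : IsPhiRegular φ) (hlam : 0 < lam) (hbdd : BddBelow (Set.range f)) (x : Rn n) :
    BddBelow (Set.range fun z => subObj f φ lam z x) := by
  obtain ⟨m, hm⟩ := hbdd
  refine ⟨m, ?_⟩
  rintro _ ⟨z, rfl⟩
  have h1 := hm ⟨z, rfl⟩
  have h2 := mul_nonneg (one_div_nonneg.2 hlam.le) (hφ.nonneg z x)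
  simp only [subObj]
  linarith

/-- Existence of proximal points. -/
theorem exists_subObj_eq_phiReg {n : ℕ} {f : Rn n → ℝ} {φ : Rn n → Rn n → ℝ} {lam : ℝ}
    (hf : ConvexOn ℝ Set.univ f) (hφ : IsPhiRegular φ) (hlam : 0 < lam)
    (hbdd : BddBelow (Set.range f)) (x : Rn n) :
    ∃ p, subObj f φ lam p x = phiReg f φ lam x ∧
      ∀ z, subObj f φ lam p x ≤ subObj f φ lam z x := by
  obtain ⟨β, L, hβ, hL, hlow, -, -⟩ := hφ.exists_bounds
  have hb := bddBelow_subObj hφ hlam hbdd x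
  obtain ⟨m, hm⟩ := hbdd
  have hcont : Continuous fun z => subObj f φ lam z x := by
    have h1 : Continuous f := hf.locallyLipschitz.continuous
    have h2 : Continuous fun z => φ z x :=
      hφ.contDiff.continuous.comp (continuous_id.prodMk continuous_const)
    unfold subObj
    fun_prop
  have hfx : 0 ≤ (f x - m) * lam :=
    mul_nonneg (sub_nonneg.2 (hm ⟨x, rfl⟩)) hlam.le
  obtain ⟨p, hp⟩ := hcont.exists_forall_le' x (by
    -- Beyond this radius the quadratic growth of `φ · x` beats its linear term by at least `(f x -
    -- m) * lam`, so the objective exceeds its value at `x`; the `max 1` lets one factor `‖z - x‖`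
    -- be dropped.
    filter_upwards [(isCompact_closedBall x
      (max 1 (((f x - m) * lam + ‖gradX φ x x‖) / β))).compl_mem_cocompact] with z hz
    rw [Set.mem_compl_iff, Metric.mem_closedBall, not_le, max_lt_iff, dist_eq_norm,
      div_lt_iff₀ hβ] at hz
    obtain ⟨h1, h2⟩ := hz
    have h3 := hlow z x x x
    have h4 : φ x x = 0 := (hφ.eq_zero_iff x x).2 rfl
    simp only [sub_self, sub_zero, h4] at h3
    have h5 := real_inner_le_norm (gradX φ x x) (z - x)
    have h6 := hm ⟨z, rfl⟩
    have h7 : (f x - m) * lam ≤ φ z x := by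
      nlinarith
    have h8 : f x - m ≤ 1 / lam * φ z x := by
      rw [one_div, inv_mul_eq_div, le_div_iff₀ hlam]
      exact h7
    simp only [subObj, h4]
    linarith)
  exact ⟨p, le_antisymm (le_ciInf hp) (ciInf_le hb p), hp⟩

/-- Optimality condition of the regularizing subproblem. -/
theorem add_inner_le_of_forall_subObj_le {n : ℕ} {f : Rn n → ℝ} {φ : Rn n → Rn n → ℝ} {lam : ℝ}
    (hf : ConvexOn ℝ Set.univ f) (hφ : IsPhiRegular φ) (hlam : 0 < lam) {x p : Rn n}
    (hp : ∀ z, subObj f φ lam p x ≤ subObj f φ lam z x) (z : Rn n) :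
    f p + (1 / lam) * inner ℝ (gradX φ p x) (z - p) ≤ f z := by
  obtain ⟨β, L, hβ, hL, -, hup, -⟩ := hφ.exists_bounds
  have hl : 0 < 1 / lam := one_div_pos.2 hlam
  -- Minimality is tested at `p + t • (z - p)` and divided by `t`; the quadratic remainder vanishes
  -- as `t → 0`.
  have key : ∀ t : ℝ, 0 < t → t ≤ 1 →
      f p + (1 / lam) * inner ℝ (gradX φ p x) (z - p) - (1 / lam * L * ‖z - p‖ ^ 2) * t ≤ f z := by
    intro t ht ht1
    have h1 := hp (p + t • (z - p))
    have h2 := hup (p + t • (z - p)) p x x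
    have h3 := hf.2 (Set.mem_univ p) (Set.mem_univ z) (sub_nonneg.2 ht1) ht.le (by ring)
    have h4 : (1 - t) • p + t • z = p + t • (z - p) := by module
    rw [h4] at h3
    simp only [smul_eq_mul] at h3
    simp only [subObj] at h1
    rw [add_sub_cancel_left, sub_self, sub_zero, inner_smul_right, norm_smul, Real.norm_eq_abs,
      mul_pow, sq_abs] at h2
    have h5 := mul_le_mul_of_nonneg_left h2 hl.le
    refine le_of_mul_le_mul_left ?_ ht
    nlinarith
  have hlim : Tendsto (fun t : ℝ => f p + (1 / lam) * inner ℝ (gradX φ p x) (z - p)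
      - (1 / lam * L * ‖z - p‖ ^ 2) * t) (𝓝[>] 0)
      (𝓝 (f p + (1 / lam) * inner ℝ (gradX φ p x) (z - p) - (1 / lam * L * ‖z - p‖ ^ 2) * 0)) :=
    (Continuous.tendsto (by fun_prop) 0).mono_left nhdsWithin_le_nhds
  rw [mul_zero, sub_zero] at hlim
  refine le_of_tendsto hlim ?_
  filter_upwards [Ioc_mem_nhdsGT (zero_lt_one (α := ℝ))] with t ht using key t ht.1 ht.2

/-- The `φ`-regularization is differentiable, and its gradient is a subgradient. The accuracy of
the approximate gradients is of the order of the square root of the error. -/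
theorem phiReg_gradient {n : ℕ} {f : Rn n → ℝ} {φ : Rn n → Rn n → ℝ} {lam : ℝ}
    (hf : ConvexOn ℝ Set.univ f) (hφ : IsPhiRegular φ) (hlam : 0 < lam)
    (hbdd : BddBelow (Set.range f)) :
    (∀ x, HasGradientAt (phiReg f φ lam) (phiGrad f φ lam x) x) ∧
    (∀ x y, phiReg f φ lam x + inner ℝ (phiGrad f φ lam x) (y - x) ≤ phiReg f φ lam y) ∧
    ∃ C : ℝ, 0 < C ∧ ∀ x z e, subObj f φ lam z x ≤ phiReg f φ lam x + e →
      ‖(1 / lam) • gradX φ z x - phiGrad f φ lam x‖ ≤ C * Real.sqrt e := by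
  have hl : 0 < 1 / lam := one_div_pos.2 hlam
  choose p hp hmin using exists_subObj_eq_phiReg hf hφ hlam hbdd
  have hopt := fun x => add_inner_le_of_forall_subObj_le hf hφ hlam (hmin x)
  obtain ⟨β, L, hβ, hL, hlow, hup, hlip⟩ := hφ.exists_bounds
  have hsub : ∀ x y, phiReg f φ lam x + inner ℝ ((1 / lam) • gradX φ (p x) x) (y - x)
      ≤ phiReg f φ lam y := by
    intro x y
    rw [← hp x, ← hp y, subObj, subObj, real_inner_smul_left]
    -- Added together, the two estimates lose their terms in `p y - p x`, and only `y - x` survives.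
    have h1 := hopt x (p y)
    have h2 := mul_le_mul_of_nonneg_left (hlow (p y) (p x) y x) hl.le
    have h3 : 0 ≤ 1 / lam * (β * ‖(p y - p x) - (y - x)‖ ^ 2) := by positivity
    rw [inner_sub_right] at h2
    linarith
  have hsup : ∀ x y, phiReg f φ lam y ≤ phiReg f φ lam x
      + inner ℝ ((1 / lam) • gradX φ (p x) x) (y - x) + 1 / lam * L * ‖y - x‖ ^ 2 := by
    intro x y
    -- The proximal point of `x` serves as a competitor at `y`.
    refine (ciInf_le (bddBelow_subObj hφ hlam hbdd y) (p x)).trans ?_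
    rw [← hp x, subObj, subObj, real_inner_smul_left]
    have h2 := mul_le_mul_of_nonneg_left (hup (p x) (p x) y x) hl.le
    rw [sub_self, zero_sub, inner_neg_right, norm_neg] at h2
    linarith
  have hgrad : ∀ x, HasGradientAt (phiReg f φ lam) ((1 / lam) • gradX φ (p x) x) x := by
    intro x
    rw [hasGradientAt_iff_isLittleO]
    have hO : (fun y => phiReg f φ lam y - phiReg f φ lam x
        - inner ℝ ((1 / lam) • gradX φ (p x) x) (y - x)) =O[𝓝 x] fun y => ‖y - x‖ ^ 2 := by
      refine IsBigO.of_bound (1 / lam * L) (Eventually.of_forall fun y => ?_)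
      rw [Real.norm_eq_abs, abs_of_nonneg (by linarith [hsub x y]), norm_pow, norm_norm]
      linarith [hsup x y]
    refine hO.trans_isLittleO ?_
    have := isLittleO_norm_pow_norm_pow (E' := Rn n) (one_lt_two)
    have h2 : Tendsto (fun y => y - x) (𝓝 x) (𝓝 0) := by
      simpa using (continuous_sub_right x).tendsto x
    refine IsLittleO.of_norm_right ?_
    simpa [Function.comp_def] using this.comp_tendsto h2
  have heq : ∀ x, phiGrad f φ lam x = (1 / lam) • gradX φ (p x) x := fun x => (hgrad x).gradient
  refine ⟨fun x => heq x ▸ hgrad x, fun x y => heq x ▸ hsub x y,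
    1 / lam * L * Real.sqrt (lam / β), by positivity, ?_⟩
  intro x z e hz
  rw [heq, ← smul_sub, norm_smul, Real.norm_eq_abs, abs_of_pos hl, mul_assoc, mul_assoc]
  refine mul_le_mul_of_nonneg_left ?_ hl.le
  have h1 := hlip z (p x) x x
  rw [sub_self, sub_zero] at h1
  refine h1.trans (mul_le_mul_of_nonneg_left ?_ hL.le)
  rw [← Real.sqrt_mul (by positivity)]
  refine Real.le_sqrt_of_sq_le ?_
  rw [← hp x, subObj, subObj] at hz
  have h2 := hopt x z
  have h3 := mul_le_mul_of_nonneg_left (hlow z (p x) x x) hl.le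
  rw [sub_self, sub_zero] at h3
  -- Strong convexity places an `e`-minimizer within `√(lam * e / β)` of `p x`; the Lipschitz bound
  -- on `gradX` converts this distance into the gradient error.
  have h4 : 1 / lam * (β * ‖z - p x‖ ^ 2) ≤ e := by linarith
  rw [div_mul_eq_mul_div, le_div_iff₀ hβ]
  rw [one_div, inv_mul_le_iff₀ hlam] at h4
  linarith

theorem phiReg_le_of_isMin {n : ℕ} {f : Rn n → ℝ} {φ : Rn n → Rn n → ℝ} {lam : ℝ}
    (hφ : IsPhiRegular φ) (hlam : 0 < lam) (hbdd : BddBelow (Set.range f)) {xbar : Rn n}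
    (hxbar : ∀ y, f xbar ≤ f y) (x : Rn n) : phiReg f φ lam xbar ≤ phiReg f φ lam x := by
  refine (ciInf_le (bddBelow_subObj hφ hlam hbdd xbar) xbar).trans (le_ciInf fun z => ?_)
  have h1 := hxbar z
  have h2 := mul_nonneg (one_div_nonneg.2 hlam.le) (hφ.nonneg z x)
  simp only [subObj, (hφ.eq_zero_iff xbar xbar).2 rfl, mul_zero]
  linarith

/-! ### The B-subdifferential and the Newton remainder. -/

theorem exists_subseq_tendsto_bSubdiff {n : ℕ} {g : Rn n → Rn n} {K : NNReal}
    (hg : LipschitzWith K g) {x : Rn n} {u : ℕ → Rn n} (hd : ∀ i, DifferentiableAt ℝ g (u i))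
    (hu : Tendsto u atTop (𝓝 x)) :
    ∃ A ∈ bSubdiff g x, ∃ s : ℕ → ℕ, StrictMono s ∧
      Tendsto (fun i => fderiv ℝ g (u (s i))) atTop (𝓝 A) := by
  obtain ⟨A, -, s, hs, hA⟩ := tendsto_subseq_of_bounded
    (Metric.isBounded_closedBall (x := (0 : Rn n →L[ℝ] Rn n)) (r := K))
    (x := fun i => fderiv ℝ g (u i)) fun i => by
      simpa using norm_fderiv_le_of_lipschitz ℝ hg
  exact ⟨A, ⟨u ∘ s, fun i => hd _, hu.comp hs.tendsto_atTop, hA⟩, s, hs, hA⟩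

theorem bSubdiff_nonempty {n : ℕ} {g : Rn n → Rn n} {K : NNReal}
    (hg : LipschitzWith K g) (x : Rn n) : (bSubdiff g x).Nonempty := by
  obtain ⟨u, hu, hux⟩ := mem_closure_iff_seq_limit.1 (MeasureTheory.Measure.dense_of_ae
    (hg.ae_differentiableAt (μ := MeasureTheory.volume)) x)
  obtain ⟨A, hA, -⟩ := exists_subseq_tendsto_bSubdiff hg hu hux
  exact ⟨A, hA⟩

theorem norm_le_of_mem_bSubdiff {n : ℕ} {g : Rn n → Rn n} {K : NNReal}
    (hg : LipschitzWith K g) {x : Rn n} {A : Rn n →L[ℝ] Rn n} (hA : A ∈ bSubdiff g x) :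
    ‖A‖ ≤ K := by
  obtain ⟨u, -, -, hu⟩ := hA
  exact le_of_tendsto hu.norm (Eventually.of_forall fun i => norm_fderiv_le_of_lipschitz ℝ hg)

/-- Upper semicontinuity of the B-subdifferential. -/
theorem eventually_exists_mem_bSubdiff_norm_sub_lt {n : ℕ} {g : Rn n → Rn n} {K : NNReal}
    (hg : LipschitzWith K g) (x : Rn n) {η : ℝ} (hη : 0 < η) :
    ∀ᶠ u in 𝓝 x, DifferentiableAt ℝ g u → ∃ B ∈ bSubdiff g x, ‖fderiv ℝ g u - B‖ < η := by
  by_contra h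
  rw [not_eventually] at h
  obtain ⟨u, hux, hu⟩ := exists_seq_forall_of_frequently h
  push Not at hu
  obtain ⟨A, hA, s, -, hsA⟩ := exists_subseq_tendsto_bSubdiff hg (fun i => (hu i).1) hux
  obtain ⟨i, hi⟩ := (Metric.tendsto_nhds.1 hsA η hη).exists
  rw [dist_eq_norm] at hi
  exact absurd hi (not_lt.2 ((hu (s i)).2 A hA))

/-- Newton estimate on a segment along which the B-subdifferential varies at a linear rate. -/
theorem norm_newton_le {n : ℕ} {g : Rn n → Rn n} {K : NNReal} (hg : LipschitzWith K g)
    {x y : Rn n} {A : Rn n →L[ℝ] Rn n} {l : ℝ} (hl : 0 ≤ l)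
    (hA : ∀ θ : ℝ, 0 ≤ θ → θ < 1 → ∀ B ∈ bSubdiff g (x + θ • (y - x)),
      ‖A - B‖ ≤ l * ‖x - (x + θ • (y - x))‖) :
    ‖g y - g x - A (y - x)‖ ≤ l * ‖y - x‖ ^ 2 := by
  set Δ := y - x with hΔ
  let q : ℝ → Rn n := fun s => g (x + s • Δ) - g x - A (s • Δ)
  have hgc := hg.continuous
  have hq : Continuous q := by fun_prop
  -- Near `x + s • Δ` every Jacobian is within `η` of a B-subdifferential element there, hence
  -- within `l * ‖Δ‖ + η` of `A`. Right slopes avoid any use of the endpoint `s = 1`.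
  have hslope : ∀ s ∈ Set.Ico (0 : ℝ) 1, ∀ r, l * ‖Δ‖ ^ 2 < r →
      ∃ᶠ z in 𝓝[>] s, slope (norm ∘ q) s z < r := by
    intro s hs r hr
    obtain ⟨η, hη, hηr⟩ : ∃ η > 0, (l * ‖Δ‖ + η) * ‖Δ‖ < r := by
      have h1 : Tendsto (fun η : ℝ => (l * ‖Δ‖ + η) * ‖Δ‖) (𝓝[>] 0)
          (𝓝 ((l * ‖Δ‖ + 0) * ‖Δ‖)) :=
        (Continuous.tendsto (by fun_prop) 0).mono_left nhdsWithin_le_nhds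
      have h2 : (l * ‖Δ‖ + 0) * ‖Δ‖ < r := by
        rw [add_zero, mul_assoc, ← sq]; exact hr
      obtain ⟨η, h3, h4⟩ := ((h1.eventually (gt_mem_nhds h2)).and self_mem_nhdsWithin).exists
      exact ⟨η, h4, h3⟩
    obtain ⟨ε, hε, hball⟩ := Metric.eventually_nhds_iff_ball.1
      (eventually_exists_mem_bSubdiff_norm_sub_lt hg (x + s • Δ) hη)
    have hlip : ∀ z, x + z • Δ ∈ Metric.ball (x + s • Δ) ε →
        ‖q z - q s‖ ≤ (l * ‖Δ‖ + η) * ‖(z - s) • Δ‖ := by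
      intro z hz
      have h := norm_sub_sub_le_of_forall_fderiv hg Metric.isOpen_ball (convex_ball _ _) (A := A)
        (c := l * ‖Δ‖ + η) (fun u hu hd => by
          obtain ⟨B, hB, hBu⟩ := hball u hu hd
          have h1 := hA s hs.1 hs.2 B hB
          have h2 : ‖x - (x + s • Δ)‖ ≤ ‖Δ‖ := by
            rw [sub_add_cancel_left, norm_neg, norm_smul, Real.norm_eq_abs, abs_of_nonneg hs.1]
            exact mul_le_of_le_one_left (norm_nonneg _) hs.2.le
          have h3 := mul_le_mul_of_nonneg_left h2 hl
          have h4 := norm_sub_le_norm_sub_add_norm_sub (fderiv ℝ g u) B A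
          rw [norm_sub_rev B A] at h4
          linarith) (Metric.mem_ball_self hε) hz
      have h5 : x + z • Δ - (x + s • Δ) = (z - s) • Δ := by module
      rw [h5] at h
      refine le_of_eq_of_le (congrArg norm ?_) h
      simp only [q, sub_smul, map_sub]
      abel
    have hnear : ∀ᶠ z in 𝓝[>] s, x + z • Δ ∈ Metric.ball (x + s • Δ) ε :=
      nhdsWithin_le_nhds ((show Continuous fun z : ℝ => x + z • Δ by fun_prop).continuousAt.eventually
        (Metric.ball_mem_nhds _ hε))
    refine Eventually.frequently ?_
    filter_upwards [hnear, self_mem_nhdsWithin] with z hz hzs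
    have hzs' : 0 < z - s := sub_pos.2 hzs
    rw [slope_def_field, div_lt_iff₀ hzs']
    have h6 := hlip z hz
    rw [norm_smul, Real.norm_eq_abs, abs_of_pos hzs'] at h6
    have h7 := norm_sub_norm_le (q z) (q s)
    simp only [Function.comp_apply]
    nlinarith
  have hall : ∀ η : ℝ, 0 < η → ‖q 1‖ ≤ l * ‖Δ‖ ^ 2 + η := by
    intro η hη
    have := image_norm_le_of_liminf_right_slope_norm_lt_deriv_boundary (f := q) (a := 0) (b := 1)
      (f' := fun _ => l * ‖Δ‖ ^ 2) (B := fun s => (l * ‖Δ‖ ^ 2 + η) * s)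
      (B' := fun _ => l * ‖Δ‖ ^ 2 + η) hq.continuousOn hslope (by simp [q])
      (by fun_prop) (fun s _ => by
        simpa using ((hasDerivAt_id s).const_mul (l * ‖Δ‖ ^ 2 + η)).hasDerivWithinAt)
      (fun s _ _ => by linarith) (Set.right_mem_Icc.2 zero_le_one)
    simpa using this
  have := le_of_forall_pos_le_add hall
  simpa [q, hΔ] using this

/-! ### Curvature and growth of a convex function with Lipschitz gradient. -/

section Gradient

variable {n : ℕ} {F : Rn n → ℝ} {g : Rn n → Rn n}

theorem inner_sub_sub_nonneg_of_subgradient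
    (hsub : ∀ x y, F x + inner ℝ (g x) (y - x) ≤ F y) (x y : Rn n) :
    0 ≤ inner ℝ (g x - g y) (x - y) := by
  have h1 := hsub x y
  have h2 := hsub y x
  rw [← neg_sub, inner_neg_right] at h1
  rw [inner_sub_left]
  linarith

theorem inner_fderiv_nonneg_of_subgradient
    (hsub : ∀ x y, F x + inner ℝ (g x) (y - x) ≤ F y) {u : Rn n} (hd : DifferentiableAt ℝ g u)
    (v : Rn n) : 0 ≤ inner ℝ v (fderiv ℝ g u v) := by
  have h1 : HasDerivAt (fun s : ℝ => u + s • v) v 0 := by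
    simpa using ((hasDerivAt_id (0 : ℝ)).smul_const v).const_add u
  have h2 : HasDerivAt (fun s : ℝ => g (u + s • v)) (fderiv ℝ g u v) 0 := by
    have h3 : HasFDerivAt g (fderiv ℝ g u) (u + (0 : ℝ) • v) := by simpa using hd.hasFDerivAt
    exact h3.comp_hasDerivAt 0 h1
  have h4 : HasDerivAt (fun s : ℝ => inner ℝ v (g (u + s • v))) (inner ℝ v (fderiv ℝ g u v)) 0 := by
    simpa using (hasDerivAt_const (0 : ℝ) v).inner ℝ h2
  have hmono : Monotone fun s : ℝ => inner ℝ v (g (u + s • v)) := by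
    intro s t hst
    rcases hst.eq_or_lt with rfl | hlt
    · exact le_rfl
    have h := inner_sub_sub_nonneg_of_subgradient hsub (u + t • v) (u + s • v)
    rw [add_sub_add_left_eq_sub, ← sub_smul, inner_smul_right, real_inner_comm,
      inner_sub_right] at h
    exact sub_nonneg.1 (nonneg_of_mul_nonneg_right h (sub_pos.2 hlt))
  rw [← h4.deriv]
  exact hmono.deriv_nonneg

theorem inner_fderiv_symm_of_hasGradientAt (hF : ∀ x, HasGradientAt F (g x) x) {u : Rn n}
    (hd : DifferentiableAt ℝ g u) (v w : Rn n) :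
    inner ℝ w (fderiv ℝ g u v) = inner ℝ v (fderiv ℝ g u w) := by
  let D : Rn n →L[ℝ] (Rn n →L[ℝ] ℝ) := innerSL ℝ
  have h1 : ∀ᶠ y in 𝓝 u, HasFDerivAt F (D (g y)) y :=
    Eventually.of_forall fun y => (hF y).hasFDerivAt
  have h2 : HasFDerivAt (fun y => D (g y)) (D.comp (fderiv ℝ g u)) u :=
    D.hasFDerivAt.comp u hd.hasFDerivAt
  have h3 : inner ℝ (fderiv ℝ g u v) w = inner ℝ (fderiv ℝ g u w) v :=
    second_derivative_symmetric_of_eventually h1 h2 v w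
  rw [real_inner_comm, h3, real_inner_comm]

/-- A positive semidefinite symmetric operator kills the vectors of vanishing quadratic form. -/
theorem eq_zero_of_inner_nonpos {A : Rn n →L[ℝ] Rn n}
    (hs : ∀ v w, inner ℝ w (A v) = inner ℝ v (A w)) (hp : ∀ v, 0 ≤ inner ℝ v (A v)) {v : Rn n}
    (hv : inner ℝ v (A v) ≤ 0) : A v = 0 := by
  by_contra hne
  have h0 : 0 < ‖A v‖ ^ 2 := by positivity
  set c := inner ℝ (A v) (A (A v)) with hc
  have hc0 : 0 ≤ c := hp (A v)
  have key : ∀ t : ℝ, 0 ≤ inner ℝ v (A v) - 2 * t * ‖A v‖ ^ 2 + t ^ 2 * c := by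
    intro t
    have h := hp (v - t • A v)
    rw [map_sub, map_smul, inner_sub_left, inner_sub_right, inner_sub_right, inner_smul_left,
      inner_smul_left, inner_smul_right, inner_smul_right, hs (A v) v,
      real_inner_self_eq_norm_sq, ← hc] at h
    simp only [conj_trivial] at h
    linarith
  -- For this small `t` the linear term outweighs the quadratic one; `c + 1` guards against `c = 0`.
  have h := key (‖A v‖ ^ 2 / (c + 1))
  have h2 : ‖A v‖ ^ 2 / (c + 1) * (c + 1) = ‖A v‖ ^ 2 := div_mul_cancel₀ _ (by positivity)
  have h3 : 0 < ‖A v‖ ^ 2 / (c + 1) := by positivity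
  nlinarith

/-- Uniform positive definiteness of the Jacobians near a point of BD-regularity. -/
theorem exists_uniform_pos_of_isBDRegular (hF : ∀ x, HasGradientAt F (g x) x)
    (hsub : ∀ x y, F x + inner ℝ (g x) (y - x) ≤ F y) {xbar : Rn n} (hBD : IsBDRegular g xbar) :
    ∃ κ > 0, ∃ r > 0, ∀ u ∈ Metric.ball xbar r, DifferentiableAt ℝ g u →
      ∀ v, κ * ‖v‖ ^ 2 ≤ inner ℝ v (fderiv ℝ g u v) := by
  obtain ⟨⟨K, hg⟩, hunit⟩ := hBD
  by_contra! h
  choose u hu hd v hv using fun i : ℕ =>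
    h (1 / ((i : ℝ) + 1)) (by positivity) (1 / ((i : ℝ) + 1)) (by positivity)
  have hux : Tendsto u atTop (𝓝 xbar) := by
    rw [tendsto_iff_dist_tendsto_zero]
    exact squeeze_zero (fun _ => dist_nonneg) (fun i => (hu i).le)
      tendsto_one_div_add_atTop_nhds_zero_nat
  have hv0 : ∀ i, 0 < ‖v i‖ := by
    intro i
    refine norm_pos_iff.2 fun h0 => ?_
    have := hv i
    simp [h0] at this
  let w : ℕ → Rn n := fun i => (‖v i‖)⁻¹ • v i
  have hw1 : ∀ i, w i ∈ Metric.sphere (0 : Rn n) 1 := by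
    intro i
    simp [w, norm_smul, (hv0 i).ne']
  have hw : ∀ i, inner ℝ (w i) (fderiv ℝ g (u i) (w i)) ≤ 1 / ((i : ℝ) + 1) := by
    intro i
    simp only [w, map_smul, inner_smul_left, inner_smul_right, conj_trivial]
    rw [← mul_assoc, ← mul_inv, inv_mul_le_iff₀ (mul_pos (hv0 i) (hv0 i))]
    linarith [hv i]
  -- Compactness yields a limit Jacobian `A` and a unit vector `z` with nonpositive quadratic form.
  -- Symmetry and semidefiniteness force `A z = 0`, against invertibility.
  obtain ⟨A, hA, s, hs, hsA⟩ := exists_subseq_tendsto_bSubdiff hg hd hux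
  obtain ⟨z, hz, t, ht, htz⟩ := (isCompact_sphere (0 : Rn n) 1).tendsto_subseq
    (fun i => hw1 (s i))
  have hAt := hsA.comp ht.tendsto_atTop
  have hlim : ∀ a b : Rn n, Tendsto (fun i => inner ℝ a (fderiv ℝ g (u (s i)) b)) atTop
      (𝓝 (inner ℝ a (A b))) := by
    intro a b
    have hc : Continuous fun T : Rn n →L[ℝ] Rn n => inner ℝ a (T b) := by fun_prop
    exact (hc.tendsto A).comp hsA
  have hsymm : ∀ a b, inner ℝ b (A a) = inner ℝ a (A b) := fun a b =>
    tendsto_nhds_unique ((hlim b a).congr fun i =>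
      inner_fderiv_symm_of_hasGradientAt hF (hd _) a b) (hlim a b)
  have hpos : ∀ a, 0 ≤ inner ℝ a (A a) := fun a =>
    ge_of_tendsto' (hlim a a) fun i => inner_fderiv_nonneg_of_subgradient hsub (hd _) a
  have hzA : inner ℝ z (A z) ≤ 0 := by
    have hc : Continuous fun q : (Rn n →L[ℝ] Rn n) × Rn n => inner ℝ q.2 (q.1 q.2) := by fun_prop
    have h1 := (hc.tendsto (A, z)).comp (hAt.prodMk_nhds htz)
    refine le_of_tendsto_of_tendsto' h1 ((tendsto_one_div_add_atTop_nhds_zero_nat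
      (𝕜 := ℝ)).comp (hs.comp ht).tendsto_atTop) fun i => hw (s (t i))
  have hAz := eq_zero_of_inner_nonpos hsymm hpos hzA
  obtain ⟨e, he⟩ := hunit A hA
  have h2 : (↑e⁻¹ * (e : Rn n →L[ℝ] Rn n)) z = z := by simp
  rw [he, mul_apply_eq_comp, hAz, map_zero] at h2
  rw [← h2] at hz
  simp at hz

theorem inner_bSubdiff_ge {xbar : Rn n} {κ r : ℝ}
    (hκ : ∀ u ∈ Metric.ball xbar r, DifferentiableAt ℝ g u →
      ∀ v, κ * ‖v‖ ^ 2 ≤ inner ℝ v (fderiv ℝ g u v)) {x : Rn n} (hx : x ∈ Metric.ball xbar r)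
    {A : Rn n →L[ℝ] Rn n} (hA : A ∈ bSubdiff g x) (v : Rn n) :
    κ * ‖v‖ ^ 2 ≤ inner ℝ v (A v) := by
  obtain ⟨u, hd, hux, huA⟩ := hA
  have hc : Continuous fun T : Rn n →L[ℝ] Rn n => inner ℝ v (T v) := by fun_prop
  refine ge_of_tendsto ((hc.tendsto A).comp huA) ?_
  filter_upwards [hux.eventually (Metric.isOpen_ball.mem_nhds hx)] with i hi using hκ _ hi (hd i) v

/-- Growth of a convex function and of its gradient away from a minimizer around which the
Jacobians of the gradient are uniformly positive definite. -/
theorem growth_of_uniform_pos {K : NNReal} (hg : LipschitzWith K g)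
    (hsub : ∀ x y, F x + inner ℝ (g x) (y - x) ≤ F y) {xbar : Rn n} (hmin : ∀ x, F xbar ≤ F x)
    (hzero : g xbar = 0) {κ r s : ℝ}
    (hκ : ∀ u ∈ Metric.ball xbar r, DifferentiableAt ℝ g u →
      ∀ v, κ * ‖v‖ ^ 2 ≤ inner ℝ v (fderiv ℝ g u v)) (hs : 0 < s) (hsr : s < r) {x : Rn n}
    (hx : s ≤ ‖x - xbar‖) :
    κ * s ≤ ‖g x‖ ∧ κ * s * (‖x - xbar‖ - s) ≤ F x - F xbar := by
  set t := ‖x - xbar‖ with ht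
  have ht0 : 0 < t := hs.trans_le hx
  -- `x` may lie outside the ball. Curvature is used only up to the point `xbar + v` at distance
  -- `s`; convexity carries the estimate on along the ray.
  set v := (s / t) • (x - xbar) with hv
  have hvn : ‖v‖ = s := by
    rw [hv, norm_smul, ← ht, Real.norm_eq_abs, abs_of_pos (by positivity)]
    field_simp
  have h1 := le_inner_sub_of_forall_fderiv hg Metric.isOpen_ball (convex_ball xbar r) (v := v)
    (w := v) (c := κ * ‖v‖ ^ 2) (fun u hu hd => hκ u hu hd v) (Metric.mem_ball_self (hs.trans hsr))
    (by simpa [hvn] using hsr)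
  rw [hzero, sub_zero, hvn] at h1
  set y := xbar + v with hy
  have hvx : inner ℝ (g y) (x - xbar) * (s / t) = inner ℝ v (g y) := by
    rw [hv, real_inner_smul_left, real_inner_comm]
    ring
  have h2 : κ * s * t ≤ inner ℝ (g y) (x - xbar) := by
    have h3 : κ * s * t * (s / t) ≤ inner ℝ (g y) (x - xbar) * (s / t) := by
      rw [hvx]
      refine le_of_eq_of_le ?_ h1
      field_simp
    exact le_of_mul_le_mul_right h3 (by positivity)
  have hxy : x - y = (1 - s / t) • (x - xbar) := by
    rw [hy, hv]; module
  have hst : 0 ≤ 1 - s / t := sub_nonneg.2 ((div_le_one ht0).2 hx)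
  constructor
  · have h4 : inner ℝ (g y) (x - xbar) ≤ inner ℝ (g x) (x - xbar) := by
      rcases hst.eq_or_lt with h0 | h0
      · rw [← h0, zero_smul, sub_eq_zero] at hxy
        rw [← hxy]
      · have h5 := inner_sub_sub_nonneg_of_subgradient hsub x y
        rw [hxy, inner_smul_right, inner_sub_left] at h5
        exact sub_nonneg.1 (nonneg_of_mul_nonneg_right h5 h0)
    have h6 := real_inner_le_norm (g x) (x - xbar)
    rw [← ht] at h6
    exact le_of_mul_le_mul_right (h2.trans (h4.trans h6)) ht0
  · have h7 := hsub y x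
    rw [hxy, inner_smul_right] at h7
    have h8 := mul_le_mul_of_nonneg_left h2 hst
    have h9 : (1 - s / t) * (κ * s * t) = κ * s * (t - s) := by field_simp
    linarith [hmin y]

end Gradient

/-! ### The nonmonotone line search. -/

/-- Positivity of the form at `d - M⁻¹ • B d`. With `B d = -G` it bounds the predicted decrease
below by `‖G‖ ^ 2 / M`. -/
theorem norm_sq_apply_le_of_isPositive {n : ℕ} {B : Rn n →L[ℝ] Rn n} (hB : B.IsPositive) {M : ℝ}
    (hM : 0 < M) (hBM : ‖B‖ ≤ M) (d : Rn n) : ‖B d‖ ^ 2 ≤ M * inner ℝ d (B d) := by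
  have h := hB.inner_nonneg_right (d - M⁻¹ • B d)
  have h1 : inner ℝ (B d) (B (B d)) ≤ M * ‖B d‖ ^ 2 := by
    refine (real_inner_le_norm _ _).trans ?_
    have := B.le_of_opNorm_le hBM (B d)
    nlinarith [norm_nonneg (B d)]
  have h2 : inner ℝ d (B (B d)) = ‖B d‖ ^ 2 := by
    rw [← real_inner_self_eq_norm_sq]
    exact (hB.isSymmetric d (B d)).symm
  rw [map_sub, map_smul, inner_sub_left, inner_sub_right, inner_sub_right, inner_smul_left,
    inner_smul_left, inner_smul_right, inner_smul_right, h2, real_inner_self_eq_norm_sq] at h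
  simp only [conj_trivial] at h
  have h3 : M⁻¹ * (M⁻¹ * inner ℝ (B d) (B (B d))) ≤ M⁻¹ * (M⁻¹ * (M * ‖B d‖ ^ 2)) := by gcongr
  have h4 : M⁻¹ * (M⁻¹ * (M * ‖B d‖ ^ 2)) = M⁻¹ * ‖B d‖ ^ 2 := by field_simp
  have h5 : M⁻¹ * ‖B d‖ ^ 2 ≤ inner ℝ d (B d) := by linarith
  rwa [inv_mul_le_iff₀ hM] at h5

/-- Values produced by a nonmonotone line search with summable errors are bounded above. -/
theorem add_two_mul_le_of_nonmonotone {v e s : ℕ → ℝ} {m : ℕ → ℕ}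
    (hv : ∀ k, v (k + 1) ≤ (Finset.range (m k + 1)).sup' Finset.nonempty_range_add_one
      (fun j => v (k - j)) + s k + e k) (hs : ∀ k, s k ≤ 0) (he0 : ∀ k, 0 ≤ e k)
    (he : ∀ k, e (k + 1) ≤ (1 / 2) * e k) (k : ℕ) : v k + 2 * e k ≤ v 0 + 2 * e 0 := by
  have hanti : Antitone e := antitone_nat_of_succ_le fun k => by linarith [he k, he0 k]
  induction k using Nat.strong_induction_on with
  | _ k ih =>
    rcases k with _ | k
    · exact le_rfl
    -- Halving gives `2 * e (k + 1) ≤ e k`, so the reserve `2 * e k` pays for both the new error and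
    -- the new reserve.
    have h1 : (Finset.range (m k + 1)).sup' Finset.nonempty_range_add_one
        (fun j => v (k - j)) ≤ v 0 + 2 * e 0 - 2 * e k := by
      refine Finset.sup'_le _ _ fun j _ => ?_
      have h2 := ih (k - j) (by omega)
      have h3 := hanti (Nat.sub_le k j)
      linarith
    linarith [hv k, hs k, he k]

/-- A nonmonotone line search with bounded memory and vanishing errors cannot keep enforcing a
fixed decrease on values that are bounded below. -/
theorem frequently_lt_of_nonmonotone {v e s : ℕ → ℝ} {m : ℕ → ℕ} {M : ℕ}
    (hv : ∀ k, v (k + 1) ≤ (Finset.range (m k + 1)).sup' Finset.nonempty_range_add_one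
      (fun j => v (k - j)) + s k + e k) (hm : ∀ k, m k ≤ M) (he : Tendsto e atTop (𝓝 0))
    {a b : ℝ} (hb : ∀ k, v k ≤ b) (ha : ∀ k, a ≤ v k) {c : ℝ} (hc : 0 < c) :
    ∃ᶠ k in atTop, -c < s k := by
  intro hev
  obtain ⟨N, hN⟩ := eventually_atTop.1 (hev.and (he.eventually (gt_mem_nhds (half_pos hc))))
  -- The memory reaches back at most `M` indices, so each further `M + 1` indices lower the bound by
  -- `c`, less an error below `c / 2`.
  have key : ∀ i k : ℕ, N + i * (M + 1) ≤ k → v k ≤ b - i * (c / 2) := by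
    intro i
    induction i with
    | zero => intro k _; simpa using hb k
    | succ i ih =>
      intro k hk
      have hexp : (i + 1) * (M + 1) = i * (M + 1) + M + 1 := by ring
      obtain ⟨k, rfl⟩ : ∃ k', k = k' + 1 := ⟨k - 1, by omega⟩
      have h1 : (Finset.range (m k + 1)).sup' Finset.nonempty_range_add_one
          (fun j => v (k - j)) ≤ b - i * (c / 2) := by
        refine Finset.sup'_le _ _ fun j hj => ih _ ?_
        have := Finset.mem_range.1 hj
        have := hm k
        omega
      have h2 := hN k (by omega)
      have h3 := not_lt.1 h2.1
      push_cast
      linarith [hv k, h2.2]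
  obtain ⟨i, hi⟩ := exists_nat_gt ((b - a) / (c / 2))
  rw [div_lt_iff₀ (half_pos hc)] at hi
  linarith [key i _ le_rfl, ha (N + i * (M + 1))]

namespace GARun.IsGenerated

variable {n : ℕ} {R : GARun n} {P : GAParams} {f : Rn n → ℝ} {φ : Rn n → Rn n → ℝ} {lam : ℝ}
  {pa : Rn n → ℝ → Rn n}

theorem shifted_isPositive (hR : R.IsGenerated P f φ lam pa) (k : ℕ) :
    (R.V k + R.α k • ContinuousLinearMap.id ℝ (Rn n)).IsPositive :=
  (hR.V_pos k).add (ContinuousLinearMap.isPositive_one.smul_of_nonneg (hR.α_pos k).le)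

theorem inner_direction (hR : R.IsGenerated P f φ lam pa) (k : ℕ) :
    inner ℝ (approxGrad φ lam pa (R.x k) (R.ε k)) (R.d k) =
      -inner ℝ (R.d k) ((R.V k + R.α k • ContinuousLinearMap.id ℝ (Rn n)) (R.d k)) := by
  rw [hR.direction, inner_neg_right, neg_neg, real_inner_comm]

theorem inner_direction_nonpos (hR : R.IsGenerated P f φ lam pa) (k : ℕ) :
    inner ℝ (approxGrad φ lam pa (R.x k) (R.ε k)) (R.d k) ≤ 0 := by
  rw [hR.inner_direction]
  exact neg_nonpos.2 ((hR.shifted_isPositive k).inner_nonneg_right _)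

/-- The forcing term is nonnegative because the direction is not one of ascent, and `ψ` is
nonincreasing. Bounded gradients thus keep the coefficient away from zero. -/
theorem min_le_coeff (hR : R.IsGenerated P f φ lam pa) (k : ℕ) {Γ : ℝ}
    (hΓ : ‖approxGrad φ lam pa (R.x k) (R.ε k)‖ ≤ Γ) :
    min P.δ (P.ψ Γ) ≤ P.coeff (approxGrad φ lam pa (R.x k) (R.ε k)) (R.d k) := by
  refine min_le_min le_rfl ?_
  have h1 := P.isForcing.nonneg _ (div_nonneg (neg_nonneg.2 (hR.inner_direction_nonpos k))
    (norm_nonneg (R.d k)))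
  have h2 := P.ψ_anti (norm_nonneg _) ((norm_nonneg _).trans hΓ) hΓ
  have h3 := mul_nonneg P.c₁_pos.le h1
  linarith

theorem value_succ_le (hR : R.IsGenerated P f φ lam pa) (k : ℕ) :
    approxVal f φ lam pa (R.x (k + 1)) (R.ε (k + 1)) ≤
      (Finset.range (R.m k + 1)).sup' Finset.nonempty_range_add_one
        (fun j => approxVal f φ lam pa (R.x (k - j)) (R.ε (k - j)))
      + P.coeff (approxGrad φ lam pa (R.x k) (R.ε k)) (R.d k) * R.τ k
          * inner ℝ (approxGrad φ lam pa (R.x k) (R.ε k)) (R.d k) + R.ε k := by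
  rw [hR.next, hR.step]
  exact (hR.exponent k).1

theorem decrease_nonpos (hR : R.IsGenerated P f φ lam pa) (k : ℕ) :
    P.coeff (approxGrad φ lam pa (R.x k) (R.ε k)) (R.d k) * R.τ k
      * inner ℝ (approxGrad φ lam pa (R.x k) (R.ε k)) (R.d k) ≤ 0 := by
  refine mul_nonpos_of_nonneg_of_nonpos (mul_nonneg ?_ ?_) (hR.inner_direction_nonpos k)
  · exact (le_min P.δ_pos.le (P.ψ_nonneg _ (norm_nonneg _))).trans (hR.min_le_coeff k le_rfl)
  · rw [hR.step]
    exact mul_nonneg (pow_nonneg P.ρ_pos.le _) P.a_pos.le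

theorem m_le (hR : R.IsGenerated P f φ lam pa) (k : ℕ) : R.m k ≤ P.M := by
  rcases k with _ | k
  · simp [hR.m_zero]
  · exact (hR.m_succ k).trans (min_le_right _ _)

theorem ε_antitone (hR : R.IsGenerated P f φ lam pa) : Antitone R.ε :=
  antitone_nat_of_succ_le fun k => by linarith [hR.ε_succ k, hR.ε_pos k]

theorem ε_tendsto (hR : R.IsGenerated P f φ lam pa) : Tendsto R.ε atTop (𝓝 0) := by
  have h : ∀ k, R.ε k ≤ R.ε 0 * (1 / 2 : ℝ) ^ k := by
    intro k
    induction k with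
    | zero => simp
    | succ k ih => rw [pow_succ]; linarith [hR.ε_succ k]
  refine squeeze_zero (fun k => (hR.ε_pos k).le) h ?_
  simpa using (tendsto_pow_atTop_nhds_zero_of_lt_one (r := (1 / 2 : ℝ)) (by norm_num)
    (by norm_num)).const_mul (R.ε 0)

end GARun.IsGenerated

/-! ### Local contraction and the inexact Newton step. -/

/-- A sequence that contracts by arbitrarily small factors close to `a`, and that comes arbitrarily
close to `a`, converges to `a` superlinearly. -/
theorem superlinear_of_local_contraction {E : Type*} [NormedAddCommGroup E] {X : ℕ → E} {a : E}
    (hstep : ∀ η > 0, ∃ ρ > 0, ∀ᶠ k in atTop, ‖X k - a‖ < ρ → ‖X (k + 1) - a‖ ≤ η * ‖X k - a‖)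
    (hfreq : ∀ ρ > 0, ∃ᶠ k in atTop, ‖X k - a‖ < ρ) (hne : ∀ᶠ k in atTop, X k ≠ a) :
    Tendsto X atTop (𝓝 a) ∧
    Tendsto (fun k => ‖X (k + 1) - a‖ / ‖X k - a‖) atTop (𝓝 0) ∧
    Tendsto (fun k => ‖X (k + 2) - a‖ / ‖X k - a‖) atTop (𝓝 0) := by
  have hlim : Tendsto (fun k => ‖X k - a‖) atTop (𝓝 0) := by
    obtain ⟨ρ, hρ, hev⟩ := hstep (1 / 2) (by norm_num)
    obtain ⟨N, hN⟩ := eventually_atTop.1 hev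
    obtain ⟨m, hmN, hm⟩ := frequently_atTop.1 (hfreq ρ hρ) N
    have hb : ∀ j : ℕ, ‖X (j + m) - a‖ ≤ (1 / 2 : ℝ) ^ j * ‖X m - a‖ := by
      intro j
      induction j with
      | zero => simp
      | succ j ih =>
        have h1 : (1 / 2 : ℝ) ^ j * ‖X m - a‖ ≤ ‖X m - a‖ :=
          mul_le_of_le_one_left (norm_nonneg _) (pow_le_one₀ (by norm_num) (by norm_num))
        have h2 := hN (j + m) (by omega) ((ih.trans h1).trans_lt hm)
        rw [pow_succ, show j + 1 + m = j + m + 1 by ring]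
        linarith
    rw [← tendsto_add_atTop_iff_nat m]
    refine squeeze_zero (fun _ => norm_nonneg _) hb ?_
    simpa using (tendsto_pow_atTop_nhds_zero_of_lt_one (r := (1 / 2 : ℝ)) (by norm_num)
      (by norm_num)).mul_const ‖X m - a‖
  have hratio : Tendsto (fun k => ‖X (k + 1) - a‖ / ‖X k - a‖) atTop (𝓝 0) := by
    rw [tendsto_order]
    refine ⟨fun b hb => Eventually.of_forall fun k => hb.trans_le (by positivity), fun b hb => ?_⟩
    obtain ⟨ρ, hρ, hev⟩ := hstep (b / 2) (by positivity)
    filter_upwards [hev, hlim.eventually (gt_mem_nhds hρ), hne] with k h1 h2 h3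
    have h4 : 0 < ‖X k - a‖ := norm_pos_iff.2 (sub_ne_zero.2 h3)
    rw [div_lt_iff₀ h4]
    nlinarith [h1 h2]
  refine ⟨tendsto_iff_norm_sub_tendsto_zero.2 hlim, hratio, ?_⟩
  have h2 := (hratio.comp (tendsto_add_atTop_nat 1)).mul hratio
  rw [mul_zero] at h2
  refine h2.congr' ?_
  filter_upwards [(tendsto_add_atTop_nat 1).eventually hne] with k hk
  have h4 : ‖X (k + 1) - a‖ ≠ 0 := norm_ne_zero_iff.2 (sub_ne_zero.2 hk)
  simp only [Function.comp_apply]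
  field_simp

/-- Error of one inexact regularized Newton step for an equation `g = 0` whose approximate
Jacobian is uniformly positive definite. -/
theorem norm_newton_step_sub_le {n : ℕ} {V A : Rn n →L[ℝ] Rn n} {α κ l δ : ℝ} (hα : 0 ≤ α)
    {x d G y xbar : Rn n} (hA : ∀ v, κ * ‖v‖ ^ 2 ≤ inner ℝ v (A v))
    (hVA : ‖V - A‖ ≤ κ / 2) (hd : (V + α • ContinuousLinearMap.id ℝ (Rn n)) d = -G)
    (hy : ‖y - A (x - xbar)‖ ≤ l * ‖x - xbar‖ ^ 2) (hG : ‖G - y‖ ≤ δ) :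
    κ / 2 * ‖x + d - xbar‖ ≤ l * ‖x - xbar‖ ^ 2 + (α + ‖V - A‖) * ‖x - xbar‖ + δ := by
  set w := x + d - xbar with hw
  have hwd : w = (x - xbar) + d := by rw [hw]; abel
  set B := V + α • ContinuousLinearMap.id ℝ (Rn n) with hB
  -- The direction equation removes `d`, leaving the Newton remainder, the matrix error, the shift
  -- and the gradient error.
  have hBw : B w = -(y - A (x - xbar)) + (V - A) (x - xbar) + α • (x - xbar) - (G - y) := by
    rw [hwd, map_add, hd]
    simp only [hB, add_apply, smul_apply,
      ContinuousLinearMap.id_apply, sub_apply]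
    abel
  have h1 : ‖B w‖ ≤ l * ‖x - xbar‖ ^ 2 + (α + ‖V - A‖) * ‖x - xbar‖ + δ := by
    rw [hBw]
    have h2 := norm_sub_le (-(y - A (x - xbar)) + (V - A) (x - xbar) + α • (x - xbar)) (G - y)
    have h3 := norm_add₃_le (a := -(y - A (x - xbar))) (b := (V - A) (x - xbar))
      (c := α • (x - xbar))
    rw [norm_neg, norm_smul, Real.norm_eq_abs, abs_of_nonneg hα] at h3
    have h4 := (V - A).le_opNorm (x - xbar)
    linarith
  refine le_trans ?_ h1
  -- Half of the coercivity of `A` absorbs `V - A`; the shift only helps.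
  have h5 : κ / 2 * ‖w‖ ^ 2 ≤ inner ℝ w (B w) := by
    have h6 : B w = A w + (V - A) w + α • w := by
      simp [hB]
    rw [h6, inner_add_right, inner_add_right, inner_smul_right, real_inner_self_eq_norm_sq]
    have h7 := (neg_le_abs _).trans (abs_real_inner_le_norm w ((V - A) w))
    have h8 := (V - A).le_of_opNorm_le hVA w
    have h9 := mul_nonneg hα (sq_nonneg ‖w‖)
    nlinarith [hA w, norm_nonneg w]
  have h10 := h5.trans (real_inner_le_norm _ _)
  rcases (norm_nonneg w).eq_or_lt with h0 | h0
  · rw [← h0, mul_zero]; exact norm_nonneg _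
  · refine le_of_mul_le_mul_left ?_ h0
    linarith

/-- With unit steps and bounded matrices, the approximate gradients become arbitrarily small. -/
theorem GARun.IsGenerated.frequently_norm_approxGrad_lt {n : ℕ} {R : GARun n} {P : GAParams}
    {f : Rn n → ℝ} {φ : Rn n → Rn n → ℝ} {lam : ℝ} {pa : Rn n → ℝ → Rn n}
    (hR : R.IsGenerated P f φ lam pa) {a b : ℝ}
    (ha : ∀ k, a ≤ approxVal f φ lam pa (R.x k) (R.ε k))
    (hb : ∀ k, approxVal f φ lam pa (R.x k) (R.ε k) ≤ b)
    {Γ M : ℝ} (hΓ : ∀ k, ‖approxGrad φ lam pa (R.x k) (R.ε k)‖ ≤ Γ) (hM : 0 < M)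
    (hB : ∀ᶠ k in atTop, ‖R.V k + R.α k • ContinuousLinearMap.id ℝ (Rn n)‖ ≤ M)
    (hτ : ∀ᶠ k in atTop, R.τ k = 1) {η : ℝ} (hη : 0 < η) :
    ∃ᶠ k in atTop, ‖approxGrad φ lam pa (R.x k) (R.ε k)‖ < η := by
  have hΓ0 : 0 < Γ := (norm_pos_iff.2 (hR.not_stop 0)).trans_le (hΓ 0)
  have hc : 0 < min P.δ (P.ψ Γ) := lt_min P.δ_pos (P.ψ_pos _ hΓ0)
  have hfreq := frequently_lt_of_nonmonotone (fun k => hR.value_succ_le k) hR.m_le hR.ε_tendsto hb ha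
    (c := min P.δ (P.ψ Γ) * (η ^ 2 / M)) (by positivity)
  refine (hfreq.and_eventually (hB.and hτ)).mono ?_
  rintro k ⟨h1, h2, h3⟩
  by_contra! h4
  have h5 := norm_sq_apply_le_of_isPositive (hR.shifted_isPositive k) hM h2 (R.d k)
  rw [hR.direction k, norm_neg] at h5
  rw [h3, mul_one, hR.inner_direction k, hR.direction k] at h1
  have h6 : η ^ 2 / M ≤ inner ℝ (R.d k) (-approxGrad φ lam pa (R.x k) (R.ε k)) := by
    rw [div_le_iff₀' hM]
    exact (pow_le_pow_left₀ hη.le h4 2).trans h5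
  have h7 := mul_le_mul (hR.min_le_coeff k (hΓ k)) h6 (by positivity)
    (hc.le.trans (hR.min_le_coeff k (hΓ k)))
  linarith

/-! ### The convergence theorem. -/

theorem theorem3 (n : ℕ) (f : Rn n → ℝ) (φ : Rn n → Rn n → ℝ) (lam : ℝ)
    (pa : Rn n → ℝ → Rn n) (P : GAParams) (R : GARun n) (xbar : Rn n)
    -- the problem, its regularization, and the run of the algorithm
    (hf : ConvexOn ℝ Set.univ f) (hφ : IsPhiRegular φ) (hlam : 0 < lam)
    (hpa : IsApproxProx f φ lam pa) (hR : R.IsGenerated P f φ lam pa)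
    -- hypotheses of the global convergence results
    (hbdd : BddBelow (Set.range f))
    (heig : ∃ C : ℝ, ∀ k : ℕ, ∀ μ : ℝ,
      Module.End.HasEigenvalue
        ((R.V k + R.α k • ContinuousLinearMap.id ℝ (Rn n) : Rn n →L[ℝ] Rn n) :
          Rn n →ₗ[ℝ] Rn n) μ → |μ| ≤ C)
    (hxbar : ∀ y, f xbar ≤ f y)
    (hBD : IsBDRegular (phiGrad f φ lam) xbar)
    -- accuracy of the subproblem solutions
    (hε : R.ε =o[atTop] fun k => ‖phiGrad f φ lam (R.x k)‖ ^ 2)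
    -- choice of the matrices and of the shifts
    (hV : Tendsto (fun k => Metric.infDist (R.V k) (bSubdiff (phiGrad f φ lam) (R.x k)))
      atTop (𝓝 0))
    (hα : Tendsto R.α atTop (𝓝 0))
    -- Lipschitz condition on the generalized Jacobians near the iterates
    (hLip : ∃ l : ℝ, ∀ᶠ k in atTop, ∀ θ : ℝ, 0 ≤ θ → θ < 1 →
      ∀ A ∈ bSubdiff (phiGrad f φ lam) (R.x k),
      ∀ B ∈ bSubdiff (phiGrad f φ lam) (R.x k + θ • (xbar - R.x k)),
        ‖A - B‖ ≤ l * ‖R.x k - (R.x k + θ • (xbar - R.x k))‖)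
    -- unit steps
    (ha : P.a = 1) (hτ : ∀ᶠ k in atTop, R.τ k = 1) :
    Tendsto R.x atTop (𝓝 xbar) ∧
    (∀ᶠ k in atTop, R.x k ≠ xbar) ∧
    Tendsto (fun k => ‖R.x (k + 1) - xbar‖ / ‖R.x k - xbar‖) atTop (𝓝 0) ∧
    Tendsto (fun k => ‖R.x (k + 2) - xbar‖ / ‖R.x k - xbar‖) atTop (𝓝 0) ∧
    ∃ C : ℝ, ∀ᶠ k in atTop,
      ‖R.x (k + 1) - xbar‖ ≤ C * (‖R.x k - xbar‖ ^ 2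
        + (R.α k + Metric.infDist (R.V k) (bSubdiff (phiGrad f φ lam) (R.x k)))
            * ‖R.x k - xbar‖
        + Real.sqrt (R.ε k)) := by
  obtain ⟨hgrad, hsub, C, hC, happ⟩ := phiReg_gradient hf hφ hlam hbdd
  have hmin := phiReg_le_of_isMin hφ hlam hbdd hxbar
  obtain ⟨κ, hκ, r, hr, hpd⟩ := exists_uniform_pos_of_isBDRegular hgrad hsub hBD
  obtain ⟨⟨K, hg⟩, -⟩ := hBD
  set g := phiGrad f φ lam with hgdef
  have hzero : g xbar = 0 := by
    have hloc : IsLocalMin (phiReg f φ lam) xbar := Eventually.of_forall hmin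
    simpa using hloc.hasFDerivAt_eq_zero (hgrad xbar).hasFDerivAt
  have hgK : ∀ x, ‖g x‖ ≤ K * ‖x - xbar‖ := fun x => by
    simpa [hzero] using hg.norm_sub_le x xbar
  have hG : ∀ k, ‖approxGrad φ lam pa (R.x k) (R.ε k) - g (R.x k)‖ ≤ C * Real.sqrt (R.ε k) :=
    fun k => happ _ _ _ (hpa _ _ (hR.ε_pos k))
  have hsqrt : Tendsto (fun k => C * Real.sqrt (R.ε k)) atTop (𝓝 0) := by
    simpa using (hR.ε_tendsto.sqrt).const_mul C
  -- the iterates avoid the minimizer, and the errors are small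
  have hsmall : ∀ η > 0, ∀ᶠ k in atTop, Real.sqrt (R.ε k) ≤ η * ‖g (R.x k)‖ := by
    intro η hη
    filter_upwards [hε.bound (sq_pos_of_pos hη)] with k hk
    rw [Real.norm_eq_abs, abs_of_pos (hR.ε_pos k), norm_pow, norm_norm, ← mul_pow] at hk
    exact (Real.sqrt_le_left (by positivity)).2 hk
  have hne : ∀ᶠ k in atTop, R.x k ≠ xbar := by
    filter_upwards [hsmall 1 one_pos] with k hk h0
    rw [h0, hzero, norm_zero, mul_zero] at hk
    exact absurd hk (not_le.2 (Real.sqrt_pos.2 (hR.ε_pos k)))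
  -- the B-subdifferential is a singleton at late iterates
  choose A hA using fun k => bSubdiff_nonempty hg (R.x k)
  obtain ⟨l, hl0, hl⟩ : ∃ l : ℝ, 0 ≤ l ∧ ∀ᶠ k in atTop, ∀ θ : ℝ, 0 ≤ θ → θ < 1 →
      ∀ B ∈ bSubdiff g (R.x k + θ • (xbar - R.x k)),
        ‖A k - B‖ ≤ l * ‖R.x k - (R.x k + θ • (xbar - R.x k))‖ := by
    obtain ⟨l, hl⟩ := hLip
    refine ⟨max l 0, le_max_right _ _, hl.mono fun k hk θ h0 h1 B hB => ?_⟩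
    exact (hk θ h0 h1 _ (hA k) B hB).trans
      (mul_le_mul_of_nonneg_right (le_max_left _ _) (norm_nonneg _))
  have hdist : ∀ᶠ k in atTop, Metric.infDist (R.V k) (bSubdiff g (R.x k)) = ‖R.V k - A k‖ := by
    filter_upwards [hl] with k hk
    have hsing : bSubdiff g (R.x k) = {A k} := by
      refine Set.eq_singleton_iff_unique_mem.2 ⟨hA k, fun B hB => ?_⟩
      -- At `θ = 0` the comparison point is the iterate itself, so the right-hand side vanishes.
      have := hk 0 le_rfl one_pos B (by simpa using hB)
      rw [zero_smul, add_zero, sub_self, norm_zero, mul_zero] at this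
      exact (sub_eq_zero.1 (norm_le_zero_iff.1 this)).symm
    rw [hsing, Metric.infDist_singleton, dist_eq_norm]
  have hVA : Tendsto (fun k => ‖R.V k - A k‖) atTop (𝓝 0) := hV.congr' hdist
  have hstep : ∀ᶠ k in atTop, ‖R.x k - xbar‖ < r →
      κ / 2 * ‖R.x (k + 1) - xbar‖ ≤ l * ‖R.x k - xbar‖ ^ 2
        + (R.α k + ‖R.V k - A k‖) * ‖R.x k - xbar‖ + C * Real.sqrt (R.ε k) := by
    filter_upwards [hl, hτ, hVA.eventually (ge_mem_nhds (half_pos hκ))] with k h1 h2 h3 h4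
    rw [hR.next, h2, one_smul]
    refine norm_newton_step_sub_le (hR.α_pos k).le
      (inner_bSubdiff_ge hpd (mem_ball_iff_norm.2 h4) (hA k)) h3 (hR.direction k) ?_ (hG k)
    have h5 := norm_newton_le hg hl0 h1
    rw [hzero, zero_sub, ← neg_sub (R.x k) xbar, map_neg, norm_neg, sub_neg_eq_add,
      ← norm_neg] at h5
    refine le_of_eq_of_le (congrArg norm ?_) h5
    abel
  -- the iterates come close to the minimizer
  have hfreq : ∀ ρ > 0, ∃ᶠ k in atTop, ‖R.x k - xbar‖ < ρ := by
    have hle : ∀ k, phiReg f φ lam (R.x k) ≤ approxVal f φ lam pa (R.x k) (R.ε k) := fun k =>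
      ciInf_le (bddBelow_subObj hφ hlam hbdd (R.x k)) _
    set b := approxVal f φ lam pa (R.x 0) (R.ε 0) + 2 * R.ε 0 with hb
    have hvb : ∀ k, approxVal f φ lam pa (R.x k) (R.ε k) ≤ b := fun k => by
      have := add_two_mul_le_of_nonmonotone
        (v := fun k => approxVal f φ lam pa (R.x k) (R.ε k)) hR.value_succ_le hR.decrease_nonpos
        (fun k => (hR.ε_pos k).le) hR.ε_succ k
      linarith [hR.ε_pos k]
    -- `F` grows at least linearly outside the ball of radius `r / 2`, while its values stay below
    -- `b`.
    have hbdd_x : ∀ k, ‖R.x k - xbar‖ ≤ r / 2 + (b - phiReg f φ lam xbar) / (κ * (r / 2)) := by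
      intro k
      have hD : 0 ≤ (b - phiReg f φ lam xbar) / (κ * (r / 2)) :=
        div_nonneg (by linarith [hmin (R.x k), hle k, hvb k]) (by positivity)
      rcases le_total (r / 2) ‖R.x k - xbar‖ with h | h
      · have h1 := (growth_of_uniform_pos hg hsub hmin hzero hpd (half_pos hr)
          (half_lt_self hr) h).2
        have h2 : ‖R.x k - xbar‖ - r / 2 ≤ (b - phiReg f φ lam xbar) / (κ * (r / 2)) := by
          rw [le_div_iff₀' (by positivity)]
          linarith [hle k, hvb k]
        linarith
      · linarith
    have hΓ : ∀ k, ‖approxGrad φ lam pa (R.x k) (R.ε k)‖ ≤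
        K * (r / 2 + (b - phiReg f φ lam xbar) / (κ * (r / 2))) + C * Real.sqrt (R.ε 0) := by
      intro k
      have h1 := norm_le_norm_add_norm_sub' (approxGrad φ lam pa (R.x k) (R.ε k)) (g (R.x k))
      have h2 := (hgK (R.x k)).trans (mul_le_mul_of_nonneg_left (hbdd_x k) K.2)
      have h3 := mul_le_mul_of_nonneg_left
        (Real.sqrt_le_sqrt (hR.ε_antitone (Nat.zero_le k))) hC.le
      linarith [hG k]
    have hB : ∀ᶠ k in atTop,
        ‖R.V k + R.α k • ContinuousLinearMap.id ℝ (Rn n)‖ ≤ (K : ℝ) + 2 := by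
      filter_upwards [hVA.eventually (ge_mem_nhds one_pos),
        hα.eventually (ge_mem_nhds one_pos)] with k h1 h2
      have h3 := norm_le_norm_add_norm_sub' (R.V k) (A k)
      have h4 := norm_le_of_mem_bSubdiff hg (hA k)
      have h5 := norm_add_le (R.V k) (R.α k • ContinuousLinearMap.id ℝ (Rn n))
      have h6 : ‖R.α k • ContinuousLinearMap.id ℝ (Rn n)‖ ≤ R.α k := by
        rw [norm_smul, Real.norm_eq_abs, abs_of_pos (hR.α_pos k)]
        exact mul_le_of_le_one_right (hR.α_pos k).le ContinuousLinearMap.norm_id_le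
      linarith
    intro ρ hρ
    set s := min (ρ / 2) (r / 2)
    have hs : 0 < s := lt_min (half_pos hρ) (half_pos hr)
    have hsr : s < r := (min_le_right _ _).trans_lt (half_lt_self hr)
    have hsρ : s < ρ := (min_le_left _ _).trans_lt (half_lt_self hρ)
    have hfr := hR.frequently_norm_approxGrad_lt (fun k => (hmin _).trans (hle k)) hvb hΓ
      (by positivity) hB hτ (half_pos (mul_pos hκ hs))
    refine (hfr.and_eventually
      (hsqrt.eventually (gt_mem_nhds (half_pos (mul_pos hκ hs))))).mono ?_
    rintro k ⟨h1, h2⟩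
    by_contra! h3
    have h4 := (growth_of_uniform_pos hg hsub hmin hzero hpd hs hsr (hsρ.le.trans h3)).1
    have h5 := norm_le_norm_add_norm_sub (approxGrad φ lam pa (R.x k) (R.ε k)) (g (R.x k))
    linarith [hG k]
  have hcontr : ∀ η > 0, ∃ ρ > 0, ∀ᶠ k in atTop, ‖R.x k - xbar‖ < ρ →
      ‖R.x (k + 1) - xbar‖ ≤ η * ‖R.x k - xbar‖ := by
    intro η hη
    -- Each of the three error terms receives a third of the allowed `κ / 2 * η * ‖R.x k - xbar‖`.
    set ζ := κ / 2 * η / 3 with hζ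
    have hζ0 : 0 < ζ := by positivity
    refine ⟨min r (ζ / (l + 1)), by positivity, ?_⟩
    have hsum : Tendsto (fun k => R.α k + ‖R.V k - A k‖) atTop (𝓝 0) := by
      simpa using hα.add hVA
    filter_upwards [hstep, hsum.eventually (ge_mem_nhds hζ0),
      hsmall (ζ / (C * (K + 1))) (by positivity)] with k h1 h2 h3 h4
    have h5 := h1 (h4.trans_le (min_le_left _ _))
    have h6 := (lt_div_iff₀ (by positivity)).1 (h4.trans_le (min_le_right _ _))
    set Δ := ‖R.x k - xbar‖
    have hΔ : 0 ≤ Δ := norm_nonneg _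
    have h7 : C * Real.sqrt (R.ε k) ≤ ζ * Δ := by
      have h8 : ‖g (R.x k)‖ ≤ (K + 1) * Δ := (hgK _).trans (by gcongr; linarith)
      calc C * Real.sqrt (R.ε k) ≤ C * (ζ / (C * (K + 1)) * ((K + 1) * Δ)) := by
            refine mul_le_mul_of_nonneg_left (h3.trans ?_) hC.le
            gcongr
        _ = ζ * Δ := by field_simp
    have h9 : l * Δ ^ 2 ≤ ζ * Δ := by nlinarith
    have h10 := mul_le_mul_of_nonneg_right h2 hΔ
    refine le_of_mul_le_mul_left ?_ (half_pos hκ)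
    have h11 : κ / 2 * (η * Δ) = 3 * (ζ * Δ) := by rw [hζ]; ring
    linarith
  obtain ⟨hlim, hQ, hQ2⟩ := superlinear_of_local_contraction hcontr hfreq hne
  refine ⟨hlim, hne, hQ, hQ2, 2 / κ * (l + 1 + C), ?_⟩
  have hnear : ∀ᶠ k in atTop, ‖R.x k - xbar‖ < r :=
    (tendsto_iff_norm_sub_tendsto_zero.1 hlim).eventually (gt_mem_nhds hr)
  filter_upwards [hstep, hdist, hnear] with k h1 h2 h3
  have h4 := h1 h3
  rw [h2]
  have h5 : 0 ≤ (R.α k + ‖R.V k - A k‖) * ‖R.x k - xbar‖ :=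
    mul_nonneg (add_nonneg (hR.α_pos k).le (norm_nonneg _)) (norm_nonneg _)
  have h6 := sq_nonneg ‖R.x k - xbar‖
  have h7 := Real.sqrt_nonneg (R.ε k)
  -- The three terms have coefficients `l`, `1` and `C`, all dominated by their sum.
  have h8 : κ / 2 * ‖R.x (k + 1) - xbar‖ ≤ (l + 1 + C) * (‖R.x k - xbar‖ ^ 2
      + (R.α k + ‖R.V k - A k‖) * ‖R.x k - xbar‖ + Real.sqrt (R.ε k)) := by
    nlinarith [mul_nonneg hl0 h5, mul_nonneg hl0 h7, mul_nonneg hC.le h5, mul_nonneg hC.le h6]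
  rw [mul_assoc, div_mul_eq_mul_div, le_div_iff₀ hκ]
  linarith
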